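/- Let $\mathfrak{B}$ be the universal unital $C^*$-algebra generated by a family $\{b_i : i\in\mathbb{Z}\}$ subject to the monotone rules: for all $i,j\in\mathbb{Z}$, $$b_ib_j=0\ \text{ if } i\le j,\qquad b_ib_jb_j^*=\alpha_{i,j}\,b_i,\qquad b_i^*b_i=b_{i-1}b_{i-1}^*-b_ib_i^*,\qquad b_ib_i^*b_j=b_j-\alpha_{i,j}\sum_{j<k\le i}b_k^*b_kb_j,$$ where $\alpha_{i,j}=1$ if $i>j$ and $\alpha_{i,j}=0$ otherwise. Let $\mathfrak{I}\subset\mathfrak{B}$ be the $C^*$-subalgebra generated by all the $b_i$ (the unit of $\mathfrak{B}$ not being adjoined), and for $n\ge 0$ let $\mathfrak{B}_n\subset\mathfrak{B}$ be the $C^*$-subalgebra generated by $\{b_i : |i|\le n\}$ (again without adjoining the unit of $\mathfrak{B}$). Then: 1. $\mathfrak{B}_0\subset\mathfrak{B}_1\subset\cdots$, and $\mathfrak{I}$ is the inductive limit of this sequence, i.e. $\mathfrak{I}=\overline{\bigcup_n\mathfrak{B}_n}$. 2. $\mathfrak{B}_n\cong M_{2^{2n+1}}(\mathbb{C})$ as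 a $*$-algebra, for every $n\ge 0$. 3. The Bratteli diagram of the sequence $(\mathfrak{B}_n)_{n\ge 0}$, hence of $\mathfrak{I}$, is $$\overset{2}{\bullet}\rightrightarrows\overset{8}{\bullet}\rightrightarrows\cdots\rightrightarrows\overset{2^{2n+1}}{\bullet}\rightrightarrows\overset{2^{2n+3}}{\bullet}\rightrightarrows\cdots$$ That is, there are $*$-isomorphisms $\varphi_n:\mathfrak{B}_n\to M_{2^{2n+1}}(\mathbb{C})$, $n\ge 0$, such that each inclusion $\mathfrak{B}_n\subset\mathfrak{B}_{n+1}$ becomes an embedding of multiplicity $2$: for every $n\ge 0$ there is a unitary $U_n$ of size $2^{2n+3}$ with $\varphi_{n+1}(x)=U_n\,\mathrm{diag}(\varphi_n(x),\varphi_n(x),0)\,U_n^*$ for all $x\in\mathfrak{B}_n$, where $0$ is the zero block of size $2^{2n+2}$. 4. In particular, $\mathfrak{I}$ is an AF-algebra: it is the norm closure of the union of an increasing sequence of finite-dimensional $*$-subalgebras. -/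

import Mathlib

open scoped ENNReal Matrix Kronecker

universe u

noncomputable section

namespace MonotoneAlgebra

/-! ### The monotone rules and the universal monotone C*-algebra -/

/-- The monotone rules for a family `b : ℤ → A` in a unital `*`-ring. -/
structure Rules {A : Type*} [Ring A] [StarRing A] (b : ℤ → A) : Prop where
  rule1 : ∀ i j : ℤ, i ≤ j → b i * b j = 0
  rule2 : ∀ i j : ℤ, b i * b j * star (b j) = if j < i then b i else 0
  rule3 : ∀ i : ℤ, star (b i) * b i = b (i - 1) * star (b (i - 1)) - b i * star (b i)
  rule4 : ∀ i j : ℤ, b i * star (b i) * b j =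
    b j - if j < i then ∑ k ∈ Finset.Ioc j i, star (b k) * b k * b j else 0

/-- Families satisfying the monotone rules consist of contractions, which is what makes the
universal C*-algebra exist. -/
theorem Rules.norm_le_one {A : Type*} [CStarAlgebra A] {b : ℤ → A} (h : Rules b) (i : ℤ) :
    ‖b i‖ ≤ 1 := by
  have h1 : b i * (star (b i) * b i) = b i := by
    rw [h.rule3, mul_sub, ← mul_assoc, ← mul_assoc, h.rule2, h.rule2]
    simp
  have h2 : (star (b i) * b i) * (star (b i) * b i) = star (b i) * b i := by
    rw [mul_assoc, h1]
  have h3 : ‖b i‖ * ‖b i‖ * (‖b i‖ * ‖b i‖) = ‖b i‖ * ‖b i‖ := by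
    have h4 := CStarRing.norm_star_mul_self (x := star (b i) * b i)
    rw [star_mul, star_star, h2, CStarRing.norm_star_mul_self] at h4
    exact h4.symm
  by_contra hc
  push Not at hc
  have h5 : 1 < ‖b i‖ * ‖b i‖ := by nlinarith
  nlinarith

/-- A realization of the monotone rules: a nonzero unital C*-algebra together with a family
indexed by `ℤ` that satisfies them. -/
structure Realization : Type (u + 1) where
  carrier : Type u
  [cstar : CStarAlgebra carrier]
  [nontrivial : Nontrivial carrier]
  gen : ℤ → carrier
  rules : Rules gen

attribute [instance] Realization.cstar Realization.nontrivial

/-- The C*-algebra of bounded families `(x_ρ)`, with `x_ρ` in the C*-algebra of the realization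
`ρ`, with the supremum norm. -/
abbrev BoundedFamilies : Type (u + 1) :=
  lp (fun ρ : Realization.{u} => ρ.carrier) ∞

instance : CStarAlgebra BoundedFamilies.{u} where

/-- The tuple of the `i`-th generators of all realizations. -/
def tuple (i : ℤ) : BoundedFamilies.{u} :=
  ⟨fun ρ => ρ.gen i, memℓp_infty ⟨1, by rintro _ ⟨ρ, rfl⟩; exact ρ.rules.norm_le_one i⟩⟩

/-- The unital C*-algebra generated by the tuples of generators of all realizations. -/
def universalSubalgebra : StarSubalgebra ℂ BoundedFamilies.{u} :=
  (StarAlgebra.adjoin ℂ (Set.range tuple.{u})).topologicalClosure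

instance : IsClosed (universalSubalgebra.{u} : Set BoundedFamilies.{u}) :=
  StarSubalgebra.isClosed_topologicalClosure _

/-- The universal unital C*-algebra `𝔅` generated by a family `b i`, `i : ℤ`, subject to the
monotone rules, constructed inside the C*-algebra of bounded families over all realizations. Its
universal property is `MonotoneAlgebra.existsUnique_lift`. -/
def Univ : Type (u + 1) := universalSubalgebra.{u}

instance univCStar : CStarAlgebra Univ.{u} :=
  StarSubalgebra.cstarAlgebra universalSubalgebra.{u}

/-- The canonical generators of the universal monotone C*-algebra. -/
def b (i : ℤ) : Univ.{u} :=
  ⟨tuple i, StarSubalgebra.le_topologicalClosure _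
    (StarAlgebra.subset_adjoin ℂ _ (Set.mem_range_self i))⟩

/-- The inclusion of the universal algebra into the algebra of bounded families. -/
def incl : Univ.{u} →⋆ₐ[ℂ] BoundedFamilies.{u} where
  toFun x := x.1
  map_one' := rfl
  map_mul' _ _ := rfl
  map_zero' := rfl
  map_add' _ _ := rfl
  commutes' _ := rfl
  map_star' _ := rfl

/-- Evaluation of an element of the universal algebra in a realization. -/
def eval (ρ : Realization.{u}) : Univ.{u} →⋆ₐ[ℂ] ρ.carrier where
  toFun x := x.1.1 ρ
  map_one' := rfl
  map_mul' _ _ := rfl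
  map_zero' := rfl
  map_add' _ _ := rfl
  commutes' _ := rfl
  map_star' _ := rfl

theorem eval_b (ρ : Realization.{u}) (i : ℤ) : eval ρ (b i) = ρ.gen i := rfl

theorem eval_ext {x y : Univ.{u}} (h : ∀ ρ, eval ρ x = eval ρ y) : x = y :=
  Subtype.ext (Subtype.ext (funext h))

theorem isInducing_val : Topology.IsInducing (fun x : Univ.{u} => (x.1 : BoundedFamilies.{u})) :=
  ⟨rfl⟩

/-- The canonical generators satisfy the monotone rules. -/
theorem rules_b : Rules b.{u} where
  rule1 i j h := eval_ext fun ρ => ρ.rules.rule1 i j h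
  rule2 i j := eval_ext fun ρ => by
    have := ρ.rules.rule2 i j
    split_ifs at this ⊢ <;> exact this
  rule3 i := eval_ext fun ρ => ρ.rules.rule3 i
  rule4 i j := eval_ext fun ρ => by
    have := ρ.rules.rule4 i j
    split_ifs at this ⊢
    · rw [map_sub, map_sum]
      exact this
    · exact this

attribute [irreducible] univCStar

/-- The canonical generators generate `𝔅` as a unital C*-algebra. -/
theorem topologicalClosure_adjoin_b :
    (StarAlgebra.adjoin ℂ (Set.range b.{u})).topologicalClosure = ⊤ := by
  refine eq_top_iff.mpr fun x _ => ?_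
  have h1 : (StarAlgebra.adjoin ℂ (Set.range b.{u})).map incl =
      StarAlgebra.adjoin ℂ (Set.range tuple) := by
    rw [StarAlgHom.map_adjoin, ← Set.range_comp]
    rfl
  have h2 : (Subtype.val '' (StarAlgebra.adjoin ℂ (Set.range b.{u}) : Set Univ.{u}) :
      Set BoundedFamilies.{u}) = StarAlgebra.adjoin ℂ (Set.range tuple) :=
    congrArg (fun S : StarSubalgebra ℂ BoundedFamilies.{u} => (S : Set BoundedFamilies.{u})) h1
  have h3 : x.1 ∈ closure (StarAlgebra.adjoin ℂ (Set.range tuple.{u}) :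
      Set BoundedFamilies.{u}) := x.2
  rw [← h2] at h3
  change x ∈ closure (StarAlgebra.adjoin ℂ (Set.range b.{u}) : Set Univ.{u})
  rw [isInducing_val.closure_eq_preimage_closure_image]
  exact h3

/-- The universal property of `𝔅`: a family satisfying the monotone rules in a unital C*-algebra
is the image of the canonical generators under exactly one unital `*`-homomorphism. -/
theorem existsUnique_lift {A : Type u} [CStarAlgebra A] (a : ℤ → A) (ha : Rules a) :
    ∃! f : Univ.{u} →⋆ₐ[ℂ] A, ∀ i, f (b i) = a i := by
  have key : ∃ f : Univ.{u} →⋆ₐ[ℂ] A, ∀ i, f (b i) = a i := by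
    rcases subsingleton_or_nontrivial A with hA | hA
    · refine ⟨⟨⟨⟨⟨⟨fun _ => 0, ?_⟩, ?_⟩, ?_, ?_⟩, ?_⟩, ?_⟩, ?_⟩ <;>
        intros <;> exact Subsingleton.elim _ _
    · exact ⟨eval ⟨A, a, ha⟩, fun i => rfl⟩
  obtain ⟨f, hf⟩ := key
  refine ⟨f, hf, fun g hg => StarAlgHom.ext fun x => ?_⟩
  have hcl : IsClosed {x : Univ.{u} | g x = f x} :=
    isClosed_eq (AddMonoidHomClass.continuous_of_bound g 1 fun y => by
        rw [one_mul]; exact NonUnitalStarAlgHom.norm_apply_le g y)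
      (AddMonoidHomClass.continuous_of_bound f 1 fun y => by
        rw [one_mul]; exact NonUnitalStarAlgHom.norm_apply_le f y)
  have hsub : (StarAlgebra.adjoin ℂ (Set.range b.{u}) : Set Univ.{u}) ⊆ {x | g x = f x} :=
    StarAlgHom.adjoin_le_equalizer g f (by rintro _ ⟨i, rfl⟩; exact (hg i).trans (hf i).symm)
  have hx : x ∈ (StarAlgebra.adjoin ℂ (Set.range b.{u})).topologicalClosure := by
    rw [topologicalClosure_adjoin_b]; trivial
  exact closure_minimal hsub hcl hx

/-! ### The algebra `𝔍` and its finite stages -/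

/-- The (not necessarily unital) C*-subalgebra generated by a set. -/
def generated {A : Type*} [CStarAlgebra A] (S : Set A) : NonUnitalStarSubalgebra ℂ A :=
  (NonUnitalStarAlgebra.adjoin ℂ S).topologicalClosure

theorem generated_mono {A : Type*} [CStarAlgebra A] {S T : Set A} (h : S ⊆ T) :
    generated S ≤ generated T :=
  NonUnitalStarSubalgebra.topologicalClosure_mono (NonUnitalStarAlgebra.adjoin_mono h)

/-- The non-unital monotone C*-algebra: the C*-subalgebra of `𝔅` generated by all the `b i`,
without adjoining the unit of `𝔅`. -/
def J : NonUnitalStarSubalgebra ℂ Univ.{u} := generated (Set.range b)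

/-- The C*-subalgebra `𝔅ₙ` of `𝔅` generated by the `b i` with `|i| ≤ n`. -/
def block (n : ℕ) : NonUnitalStarSubalgebra ℂ Univ.{u} :=
  generated (b '' {i : ℤ | |i| ≤ (n : ℤ)})

theorem block_mono : Monotone block.{u} := fun m _ h =>
  generated_mono (Set.image_mono fun i (hi : |i| ≤ (m : ℤ)) =>
    hi.trans (Int.ofNat_le.mpr h))

/-! ### AF-algebras and Bratteli diagrams -/

/-- `K` is the inductive limit of the increasing sequence `F` of `*`-subalgebras of `A`: the norm
closure of its union. -/
def IsInductiveLimit {A : Type*} [CStarAlgebra A] (K : NonUnitalStarSubalgebra ℂ A)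
    (F : ℕ → NonUnitalStarSubalgebra ℂ A) : Prop :=
  Monotone F ∧ closure (⋃ n, (F n : Set A)) = (K : Set A)

/-- `K` is approximately finite-dimensional: the norm closure of the union of an increasing
sequence of finite-dimensional `*`-subalgebras. -/
def IsAF {A : Type*} [CStarAlgebra A] (K : NonUnitalStarSubalgebra ℂ A) : Prop :=
  ∃ F : ℕ → NonUnitalStarSubalgebra ℂ A,
    IsInductiveLimit K F ∧ ∀ n, FiniteDimensional ℂ (F n)

/-- A Bratteli diagram: finitely many vertices at each level, each vertex `v` labelled by a positive
integer `dim n v`, and `mult n v w` arrows from the vertex `v` at level `n` to the vertex `w` at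
level `n + 1`. -/
structure BratteliDiagram where
  vertex : ℕ → Type
  [fintype : ∀ n, Fintype (vertex n)]
  [decidableEq : ∀ n, DecidableEq (vertex n)]
  dim : ∀ n, vertex n → ℕ
  dim_pos : ∀ n v, 0 < dim n v
  mult : ∀ n, vertex n → vertex (n + 1) → ℕ

attribute [instance] BratteliDiagram.fintype BratteliDiagram.decidableEq

/-- The direct sum of the full matrix algebras attached to the vertices at level `n`. -/
abbrev BratteliDiagram.matrices (D : BratteliDiagram) (n : ℕ) : Type :=
  ∀ v : D.vertex n, Matrix (Fin (D.dim n v)) (Fin (D.dim n v)) ℂ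

/-- The block diagonal matrix that contains the matrix `x v`, for each vertex `v` at level `n`,
exactly `mult n v w` times and in addition a zero block of size `r`. -/
def BratteliDiagram.amplification (D : BratteliDiagram) (n : ℕ) (w : D.vertex (n + 1)) (r : ℕ)
    (x : D.matrices n) :
    Matrix ((Σ v : D.vertex n, Fin (D.mult n v w) × Fin (D.dim n v)) ⊕ Fin r)
      ((Σ v : D.vertex n, Fin (D.mult n v w) × Fin (D.dim n v)) ⊕ Fin r) ℂ :=
  Matrix.fromBlocks
    (Matrix.blockDiagonal' fun v : D.vertex n =>
      (1 : Matrix (Fin (D.mult n v w)) (Fin (D.mult n v w)) ℂ) ⊗ₖ x v)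
    0 0 0

/-- `D` is the Bratteli diagram of the increasing sequence `F` of `*`-algebras: each `F n` is
identified with the direct sum of the full matrix algebras at level `n`, and in each matrix block `w`
at level `n + 1` the inclusion of `F n` into `F (n + 1)` is, up to a unitary change of basis `U`, the
block diagonal map that repeats the block `v` at level `n` exactly `mult n v w` times. -/
def BratteliDiagram.IsDiagramOf (D : BratteliDiagram) {A : Type*} [CStarAlgebra A]
    (F : ℕ → NonUnitalStarSubalgebra ℂ A) (hF : Monotone F) : Prop :=
  ∃ φ : ∀ n, F n ≃⋆ₐ[ℂ] D.matrices n,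
    ∀ (n : ℕ) (w : D.vertex (n + 1)), ∃ (r : ℕ)
      (U : Matrix (Fin (D.dim (n + 1) w))
        ((Σ v : D.vertex n, Fin (D.mult n v w) × Fin (D.dim n v)) ⊕ Fin r) ℂ),
      U * Uᴴ = 1 ∧ Uᴴ * U = 1 ∧
      ∀ x : F n,
        φ (n + 1) (NonUnitalStarSubalgebra.inclusion (hF n.le_succ) x) w =
          U * D.amplification n w r (φ n x) * Uᴴ

/-- The diagram with one vertex at each level `n`, labelled `2 ^ (2 * n + 1)`, and two arrows from
each level to the next. -/
def chain : BratteliDiagram where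
  vertex _ := Unit
  dim n _ := 2 ^ (2 * n + 1)
  dim_pos _ _ := by positivity
  mult _ _ _ := 2

end MonotoneAlgebra

end

noncomputable section

namespace MonotoneAlgebra

/-! ### A realization by partial translations -/

section Model

variable {X : Type u}

/-! Write `p i = b i * star (b i)`. The rules make these projections decrease in `i`, and `star (b
i) * b i = p (i - 1) - p i`. In the dyadic picture on the half-line, `p i` is the interval [0,
2^(-i)) and `b i` moves its right neighbour of equal length onto it. Composing such moves according
to the binary digits of `k` gives a partial isometry `word b n k` from the `k`-th interval of length
2^(-n) onto the first.

For `k < 2 ^ (2n+1)` the products `star (word b n k) * word b n l` are therefore matrix units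
(`Rules.word_mul_star_word`). They span the `n`-th stage, since every generator with `|i| ≤ n` is a
sum of them (`Rules.gen_eq_sum`). They are nonzero because the dyadic picture is an actual
realization (`rules_modelGen`, `b_ne_zero`). Passing to `n + 1` halves each interval, so each matrix
unit becomes a sum of two (`Rules.star_word_mul_word`); this is the multiplicity 2. The intervals
added at the far end account for the zero block. -/

open Classical in
/-- The operator `v ↦ 1_Q · (v ∘ e)` on `ℓ²(X)`. -/
def partialComp (e : X ≃ X) (Q : Set X) :
    lp (fun _ : X => ℂ) 2 →L[ℂ] lp (fun _ : X => ℂ) 2 :=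
  have key (v : lp (fun _ : X => ℂ) 2) :
      Summable (fun x => ‖if x ∈ Q then v (e x) else 0‖ ^ (2 : ℝ≥0∞).toReal) ∧
      ∑' x, ‖if x ∈ Q then v (e x) else 0‖ ^ (2 : ℝ≥0∞).toReal ≤ ‖v‖ ^ (2 : ℝ≥0∞).toReal := by
    have h0 : 0 < (2 : ℝ≥0∞).toReal := by norm_num
    have h1 : HasSum (fun x => ‖v (e x)‖ ^ (2 : ℝ≥0∞).toReal) (‖v‖ ^ (2 : ℝ≥0∞).toReal) :=
      e.hasSum_iff.mpr (lp.hasSum_norm h0 v)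
    have h2 : ∀ x, ‖if x ∈ Q then v (e x) else 0‖ ^ (2 : ℝ≥0∞).toReal ≤
        ‖v (e x)‖ ^ (2 : ℝ≥0∞).toReal := fun x => by
      split_ifs
      · exact le_rfl
      · rw [norm_zero, Real.zero_rpow h0.ne']
        positivity
    have h3 := Summable.of_nonneg_of_le (fun x => by positivity) h2 h1.summable
    exact ⟨h3, (h3.tsum_le_tsum h2 h1.summable).trans_eq h1.tsum_eq⟩
  LinearMap.mkContinuous
    { toFun := fun v => ⟨fun x => if x ∈ Q then v (e x) else 0, memℓp_gen (key v).1⟩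
      map_add' := fun v w => by
        refine Subtype.ext (funext fun x => ?_)
        change (if x ∈ Q then v (e x) + w (e x) else 0) =
          (if x ∈ Q then v (e x) else 0) + if x ∈ Q then w (e x) else 0
        split_ifs <;> simp
      map_smul' := fun c v => by
        ext x
        by_cases h : x ∈ Q <;> simp [h] }
    1 fun v => by
      rw [one_mul]
      exact lp.norm_le_of_tsum_le (by norm_num) (norm_nonneg _) (key v).2

open Classical in
theorem partialComp_apply (e : X ≃ X) (Q : Set X) (v : lp (fun _ : X => ℂ) 2) (x : X) :
    partialComp e Q v x = if x ∈ Q then v (e x) else 0 := rfl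

/-- Change of variables along `e` in the inner product. -/
theorem star_partialComp (e : X ≃ X) (Q : Set X) :
    star (partialComp e Q) = partialComp e.symm (e.symm ⁻¹' Q) := by
  rw [ContinuousLinearMap.star_eq_adjoint]
  symm
  rw [ContinuousLinearMap.eq_adjoint_iff]
  intro v w
  rw [lp.inner_eq_tsum, lp.inner_eq_tsum, ← e.tsum_eq]
  refine tsum_congr fun x => ?_
  by_cases h : x ∈ Q <;> simp [partialComp_apply, h]

end Model

/-- The translation by `2 ^ (-i)` restricted to `[2 ^ (-i), 2 ^ (1 - i))`, on `ℓ²(ℝ)`. -/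
def modelGen (i : ℤ) : lp (fun _ : ULift.{u} ℝ => ℂ) 2 →L[ℂ] lp (fun _ : ULift.{u} ℝ => ℂ) 2 :=
  partialComp ((Equiv.ulift.trans (Equiv.addRight ((2 : ℝ) ^ (-i)))).trans Equiv.ulift.symm)
    {x | 0 ≤ x.down ∧ x.down < (2 : ℝ) ^ (-i)}

open Classical in
theorem modelGen_apply (i : ℤ) (v : lp (fun _ : ULift.{u} ℝ => ℂ) 2) (x : ULift.{u} ℝ) :
    modelGen i v x =
      if 0 ≤ x.down ∧ x.down < (2 : ℝ) ^ (-i) then v ⟨x.down + (2 : ℝ) ^ (-i)⟩ else 0 := by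
  simp [modelGen, partialComp_apply]

open Classical in
theorem star_modelGen_apply (i : ℤ) (v : lp (fun _ : ULift.{u} ℝ => ℂ) 2) (x : ULift.{u} ℝ) :
    star (modelGen i) v x =
      if (2 : ℝ) ^ (-i) ≤ x.down ∧ x.down < (2 : ℝ) ^ (-i) + (2 : ℝ) ^ (-i)
      then v ⟨x.down - (2 : ℝ) ^ (-i)⟩ else 0 := by
  rw [modelGen, star_partialComp, partialComp_apply]
  simp [sub_eq_add_neg]

theorem modelGen_mul_star_apply (i : ℤ) (v : lp (fun _ : ULift.{u} ℝ => ℂ) 2)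
    (x : ULift.{u} ℝ) : (modelGen i * star (modelGen i)) v x =
      if 0 ≤ x.down ∧ x.down < (2 : ℝ) ^ (-i) then v x else 0 := by
  rw [mul_apply_eq_comp, modelGen_apply, star_modelGen_apply]
  by_cases h : 0 ≤ x.down ∧ x.down < (2 : ℝ) ^ (-i)
  · rw [if_pos h, if_pos h, if_pos]
    · simp
    · constructor <;> simp only <;> linarith
  · rw [if_neg h, if_neg h]

theorem star_modelGen_mul_apply (i : ℤ) (v : lp (fun _ : ULift.{u} ℝ => ℂ) 2)
    (x : ULift.{u} ℝ) : (star (modelGen i) * modelGen i) v x =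
      if (2 : ℝ) ^ (-i) ≤ x.down ∧ x.down < (2 : ℝ) ^ (-i) + (2 : ℝ) ^ (-i) then v x else 0 := by
  rw [mul_apply_eq_comp, star_modelGen_apply, modelGen_apply]
  by_cases h : (2 : ℝ) ^ (-i) ≤ x.down ∧ x.down < (2 : ℝ) ^ (-i) + (2 : ℝ) ^ (-i)
  · rw [if_pos h, if_pos h, if_pos]
    · simp
    · constructor <;> simp only <;> linarith
  · rw [if_neg h, if_neg h]

/-- The last of the monotone rules follows from the third one by telescoping. -/
theorem Rules.of_telescoping {A : Type*} [Ring A] [StarRing A] {b : ℤ → A}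
    (h1 : ∀ i j : ℤ, i ≤ j → b i * b j = 0)
    (h2 : ∀ i j : ℤ, b i * b j * star (b j) = if j < i then b i else 0)
    (h3 : ∀ i : ℤ, star (b i) * b i = b (i - 1) * star (b (i - 1)) - b i * star (b i))
    (h4 : ∀ i j : ℤ, i ≤ j → b i * star (b i) * b j = b j) : Rules b where
  rule1 := h1
  rule2 := h2
  rule3 := h3
  rule4 i j := by
    split_ifs with hji
    · have tel : ∀ i, j ≤ i → ∑ k ∈ Finset.Ioc j i, star (b k) * b k =
          b j * star (b j) - b i * star (b i) := fun i hi => by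
        induction i, hi using Int.leInduction with
        | base => simp
        | succ k hk ih =>
          rw [← Finset.insert_Ioc_right_eq_Ioc_add_one hk, Finset.sum_insert (by simp), ih, h3]
          simp
      rw [← Finset.sum_mul, tel i hji.le, sub_mul, h4 j j le_rfl]
      abel
    · rw [sub_zero, h4 i j (not_lt.mp hji)]

/-- Each rule is a fact about intervals: [0, 2^(-i)) shrinks as `i` grows, and doubling its length
gives the interval for `i - 1`. -/
theorem rules_modelGen : Rules modelGen.{u} := by
  have pos (i : ℤ) : (0 : ℝ) < (2 : ℝ) ^ (-i) := by positivity
  have anti {i j : ℤ} (h : i ≤ j) : (2 : ℝ) ^ (-j) ≤ (2 : ℝ) ^ (-i) :=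
    zpow_le_zpow_right₀ one_le_two (neg_le_neg h)
  have dbl (i : ℤ) : (2 : ℝ) ^ (-(i - 1)) = (2 : ℝ) ^ (-i) + (2 : ℝ) ^ (-i) := by
    rw [show -(i - 1) = -i + 1 by ring, zpow_add_one₀ two_ne_zero, mul_two]
  refine .of_telescoping (fun i j h => ?_) (fun i j => ?_) (fun i => ?_) (fun i j h => ?_)
  · ext v x
    rw [mul_apply_eq_comp, modelGen_apply, modelGen_apply]
    split_ifs with h1 h2
    · have := anti h
      simp only at h2
      linarith
    · rfl
    · rfl
  · ext v x
    rw [mul_assoc, mul_apply_eq_comp, modelGen_apply, modelGen_mul_star_apply]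
    by_cases hji : j < i
    -- The shifted point lies below 2^(1-i) ≤ 2^(-j), so the range projection of `b j` fixes it.
    · have h1 := anti (show j ≤ i - 1 by lia)
      rw [dbl] at h1
      rw [if_pos hji, modelGen_apply]
      split_ifs with h2 h3
      · rfl
      · exact absurd ⟨by have := pos i; simp only; linarith, by simp only; linarith⟩ h3
      · rfl
    · have h1 := anti (not_lt.mp hji)
      rw [if_neg hji]
      split_ifs with h2 h3
      · simp only at h3
        linarith
      · rfl
      · rfl
  · ext v x
    rw [star_modelGen_mul_apply, sub_apply, lp.coeFn_sub, Pi.sub_apply,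
      modelGen_mul_star_apply, modelGen_mul_star_apply, dbl]
    have := pos i
    split_ifs <;> first | (simp; done) | (exfalso; grind)
  · ext v x
    rw [mul_apply_eq_comp, modelGen_mul_star_apply, modelGen_apply]
    have := anti h
    split_ifs <;> first | rfl | (exfalso; grind)

theorem modelGen_ne_zero (i : ℤ) : modelGen.{u} i ≠ 0 := fun h => by
  -- The point mass at 2^(-i) is sent to a vector with value 1 at 0.
  have h1 := modelGen_apply i (lp.single 2 (⟨(2 : ℝ) ^ (-i)⟩ : ULift.{u} ℝ) (1 : ℂ)) ⟨0⟩
  rw [h] at h1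
  simp at h1
  exact absurd h1 (not_le.mpr (by positivity))

theorem b_ne_zero (i : ℤ) : b.{u} i ≠ 0 := fun h => by
  obtain ⟨f, hf, -⟩ := existsUnique_lift modelGen.{u} rules_modelGen
  exact modelGen_ne_zero.{u} i (by rw [← hf, h, map_zero])

/-! ### Matrix units from partial isometries with orthogonal initial projections -/

section MatrixUnits

variable {A : Type*} [Ring A] [StarRing A] [Algebra ℂ A] [StarModule ℂ A]
  {ι : Type*} [Fintype ι] [DecidableEq ι]

/-- The matrix units `star (w i) * w j` attached to a family of partial isometries with common range
projection `r` and pairwise orthogonal initial projections. -/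
def matrixHom (w : ι → A) (r : A) (hw : ∀ i j, w i * star (w j) = if i = j then r else 0)
    (hr : ∀ i, r * w i = w i) : Matrix ι ι ℂ →⋆ₙₐ[ℂ] A where
  toFun X := ∑ i, ∑ j, X i j • (star (w i) * w j)
  map_smul' c X := by simp [Finset.smul_sum, smul_smul]
  map_zero' := by simp
  map_add' X Y := by simp [add_smul, Finset.sum_add_distrib]
  map_mul' X Y := by
    have key (i j k l : ι) : X i j • (star (w i) * w j) * (Y k l • (star (w k) * w l)) =
        if k = j then (X i j * Y j l) • (star (w i) * w l) else 0 := by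
      rw [smul_mul_smul_comm, mul_assoc, ← mul_assoc (w j), hw]
      by_cases h : j = k
      · simp [h, hr]
      · simp [h, Ne.symm h]
    simp only [Finset.sum_mul_sum, key, Matrix.mul_apply, Finset.sum_smul]
    refine Finset.sum_congr rfl fun i _ => ?_
    rw [Finset.sum_comm]
    refine Finset.sum_congr rfl fun k _ => ?_
    rw [Finset.sum_comm]
    simp
  map_star' X := by
    simp only [star_sum, star_smul, star_mul, star_star, Matrix.star_apply]
    exact Finset.sum_comm

variable {w : ι → A} {r : A} {hw : ∀ i j, w i * star (w j) = if i = j then r else 0}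
  {hr : ∀ i, r * w i = w i}

theorem matrixHom_apply (X : Matrix ι ι ℂ) :
    matrixHom w r hw hr X = ∑ i, ∑ j, X i j • (star (w i) * w j) := rfl

/-- Compression recovers the matrix entries, so injectivity only needs `r ≠ 0`. -/
theorem mul_matrixHom_mul_star (X : Matrix ι ι ℂ) (i j : ι) :
    w i * matrixHom w r hw hr X * star (w j) = X i j • r := by
  have key (k l : ι) : w i * X k l • (star (w k) * w l) * star (w j) =
      if i = k then if l = j then X k l • r else 0 else 0 := by
    rw [mul_smul_comm, smul_mul_assoc, ← mul_assoc, hw]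
    split_ifs with h1 h2
    · rw [hr, hw, if_pos h2]
    · rw [hr, hw, if_neg h2, smul_zero]
    · simp
  simp only [matrixHom_apply, Finset.mul_sum, Finset.sum_mul, key]
  simp

theorem matrixHom_injective (h : r ≠ 0) : Function.Injective (matrixHom w r hw hr) :=
  (injective_iff_map_eq_zero _).mpr fun X hX => by
    ext i j
    have h1 := mul_matrixHom_mul_star (hw := hw) (hr := hr) X i j
    rw [hX, mul_zero, zero_mul] at h1
    simpa [h] using h1.symm

end MatrixUnits

/-! ### The partial isometries attached to binary expansions -/

namespace Rules

variable {A : Type*} [Ring A] [StarRing A] {b : ℤ → A}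

theorem range_mul_gen (h : Rules b) {i j : ℤ} (hij : i ≤ j) : b i * star (b i) * b j = b j := by
  rw [h.rule4, if_neg (not_lt.mpr hij), sub_zero]

theorem gen_mul_range (h : Rules b) {i j : ℤ} (hij : j < i) : b i * (b j * star (b j)) = b i := by
  rw [← mul_assoc, h.rule2, if_pos hij]

theorem range_mul_range (h : Rules b) {i j : ℤ} (hij : i ≤ j) :
    b j * star (b j) * (b i * star (b i)) = b j * star (b j) := by
  have h1 := congrArg star (h.range_mul_gen hij)
  rw [star_mul, star_mul, star_star] at h1
  rw [mul_assoc, h1]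

end Rules

section Word

variable {A : Type*} [Ring A] [StarRing A]

/-- If `k = 2 ^ s₁ + ⋯ + 2 ^ sₘ` with `s₁ < ⋯ < sₘ`, this is `q * b (n - s₁) * ⋯ * b (n - sₘ)`, where
`q` is the range projection of `b n`. -/
def word (b : ℤ → A) (n : ℤ) (k : ℕ) : A :=
  if _h : k = 0 then b n * star (b n) else word b n (k - 2 ^ Nat.log 2 k) * b (n - Nat.log 2 k)
termination_by k
decreasing_by exact Nat.sub_lt (Nat.pos_of_ne_zero _h) (by positivity)

variable {b : ℤ → A} {n : ℤ}

theorem word_zero : word b n 0 = b n * star (b n) := by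
  rw [word]
  simp

theorem word_add_two_pow {k s : ℕ} (hk : k < 2 ^ s) :
    word b n (k + 2 ^ s) = word b n k * b (n - s) := by
  have h1 : Nat.log 2 (k + 2 ^ s) = s :=
    Nat.log_eq_of_pow_le_of_lt_pow (by lia) (by rw [pow_succ]; lia)
  have h2 : k + 2 ^ s ≠ 0 := by positivity
  rw [word, dif_neg h2, h1, Nat.add_sub_cancel]

/-- Induction on the number of binary digits. -/
theorem word_induction {P : ℕ → ℕ → Prop} (zero : P 0 0)
    (low : ∀ s k, k < 2 ^ s → P s k → P (s + 1) k)
    (high : ∀ s k, k < 2 ^ s → P s k → P (s + 1) (k + 2 ^ s)) (s k : ℕ) (hk : k < 2 ^ s) :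
    P s k := by
  induction s generalizing k with
  | zero =>
    obtain rfl : k = 0 := by simpa using hk
    exact zero
  | succ s ih =>
    rcases lt_or_ge k (2 ^ s) with h | h
    · exact low s k h (ih k h)
    · obtain ⟨l, rfl⟩ := Nat.exists_eq_add_of_le' h
      rw [pow_succ] at hk
      exact high s l (by lia) (ih l (by lia))

theorem Rules.range_mul_word (h : Rules b) (s k : ℕ) (hk : k < 2 ^ s) :
    b n * star (b n) * word b n k = word b n k := by
  refine word_induction (P := fun _ k => b n * star (b n) * word b n k = word b n k)
    ?_ (fun _ _ _ => id) (fun s k hk ih => ?_) s k hk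
  · rw [word_zero, ← mul_assoc, h.range_mul_gen le_rfl]
  · rw [word_add_two_pow hk, ← mul_assoc, ih]

/-- The `k`-th small interval lies inside the first 2^s of them, whose union is the interval of `b
(n - s)`. -/
theorem Rules.word_mul_range (h : Rules b) (s k : ℕ) (hk : k < 2 ^ s) :
    word b n k * (b (n - s) * star (b (n - s))) = word b n k := by
  refine word_induction
    (P := fun s k => word b n k * (b (n - s) * star (b (n - s))) = word b n k)
    ?_ (fun s k hk ih => ?_) (fun s k hk ih => ?_) s k hk
  · rw [word_zero, Nat.cast_zero, sub_zero, ← mul_assoc, h.range_mul_gen le_rfl]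
  · nth_rw 1 [← ih]
    rw [mul_assoc, h.range_mul_range (by push_cast; lia), ih]
  · rw [word_add_two_pow hk, mul_assoc, h.gen_mul_range (by push_cast; lia)]

theorem Rules.word_mul_star_gen (h : Rules b) (s k : ℕ) (hk : k < 2 ^ s) :
    word b n k * star (b (n - s)) = 0 := by
  rw [← h.word_mul_range s k hk, mul_assoc, mul_assoc, ← star_mul, h.rule1 _ _ le_rfl, star_zero,
    mul_zero, mul_zero]

theorem Rules.word_mul_star_word (h : Rules b) (s k l : ℕ) (hk : k < 2 ^ s) (hl : l < 2 ^ s) :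
    word b n k * star (word b n l) = if k = l then b n * star (b n) else 0 := by
  induction s generalizing k l with
  | zero =>
    obtain rfl : k = 0 := by simpa using hk
    obtain rfl : l = 0 := by simpa using hl
    rw [if_pos rfl, word_zero, star_mul, star_star, ← mul_assoc, h.range_mul_gen le_rfl]
  | succ s ih =>
    have mixed (k l : ℕ) (hk : k < 2 ^ s) (hl : l < 2 ^ s) :
        word b n k * star (word b n (l + 2 ^ s)) = 0 := by
      rw [word_add_two_pow hl, star_mul, ← mul_assoc, h.word_mul_star_gen s k hk, zero_mul]
    rw [pow_succ] at hk hl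
    rcases lt_or_ge k (2 ^ s) with hk' | hk' <;> rcases lt_or_ge l (2 ^ s) with hl' | hl'
    · exact ih k l hk' hl'
    · obtain ⟨l, rfl⟩ := Nat.exists_eq_add_of_le' hl'
      rw [mixed k l hk' (by lia), if_neg (by lia)]
    · obtain ⟨k, rfl⟩ := Nat.exists_eq_add_of_le' hk'
      rw [← star_star (word b n (k + _)), ← star_mul, mixed l k hl' (by lia), star_zero,
        if_neg (by lia)]
    · obtain ⟨k, rfl⟩ := Nat.exists_eq_add_of_le' hk'
      obtain ⟨l, rfl⟩ := Nat.exists_eq_add_of_le' hl'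
      have hk0 : k < 2 ^ s := by lia
      have hl0 : l < 2 ^ s := by lia
      -- The common top digit contributes the range projection of `b (n - s)`, which the shorter
      -- word absorbs.
      rw [word_add_two_pow hk0, word_add_two_pow hl0, star_mul, mul_assoc, ← mul_assoc (b _),
        ← mul_assoc, h.word_mul_range s k hk0, ih k l hk0 hl0]
      simp

/-- The first 2^s small intervals tile the large one. Inductively, the words with top digit `s` add
`star (b (n - s)) * b (n - s)`, and `rule3` closes the step. -/
theorem Rules.sum_star_word_mul_word (h : Rules b) (s : ℕ) :
    ∑ k ∈ Finset.range (2 ^ s), star (word b n k) * word b n k =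
      b (n - s) * star (b (n - s)) := by
  induction s with
  | zero => simp [word_zero, ← mul_assoc, h.range_mul_gen le_rfl]
  | succ s ih =>
    have h1 : ∀ k ∈ Finset.range (2 ^ s),
        star (word b n (2 ^ s + k)) * word b n (2 ^ s + k) =
          star (b (n - s)) * (star (word b n k) * word b n k) * b (n - s) := fun k hk => by
      rw [add_comm, word_add_two_pow (Finset.mem_range.mp hk), star_mul]
      noncomm_ring
    rw [pow_succ, mul_two, Finset.sum_range_add, Finset.sum_congr rfl h1, ← Finset.sum_mul,
      ← Finset.mul_sum, ih, mul_assoc (star _), h.range_mul_gen le_rfl, h.rule3]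
    push_cast
    rw [add_sub_cancel, sub_sub]

theorem Rules.gen_eq_sum (h : Rules b) (s : ℕ) :
    b (n - s) = ∑ k ∈ Finset.range (2 ^ s), star (word b n k) * word b n (k + 2 ^ s) := by
  have h1 : ∀ k ∈ Finset.range (2 ^ s), star (word b n k) * word b n (k + 2 ^ s) =
      star (word b n k) * word b n k * b (n - s) := fun k hk => by
    rw [word_add_two_pow (Finset.mem_range.mp hk), mul_assoc]
  rw [Finset.sum_congr rfl h1, ← Finset.sum_mul, h.sum_star_word_mul_word,
    h.range_mul_gen le_rfl]

/-- Passing from `n` to `n + 1` shifts every digit up by one place and leaves a free lowest digit: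
the left or right half of the interval. -/
theorem Rules.word_succ (h : Rules b) (s k : ℕ) (hk : k < 2 ^ s) :
    word b (n + 1) (2 * k) = b (n + 1) * star (b (n + 1)) * word b n k ∧
      word b (n + 1) (2 * k + 1) = b (n + 1) * word b n k := by
  refine word_induction (P := fun _ k =>
    word b (n + 1) (2 * k) = b (n + 1) * star (b (n + 1)) * word b n k ∧
      word b (n + 1) (2 * k + 1) = b (n + 1) * word b n k)
    ?_ (fun _ _ _ => id) (fun s k hk ih => ?_) s k hk
  · have h1 : b (n + 1) * (b n * star (b n)) = b (n + 1) := h.gen_mul_range (by lia)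
    refine ⟨by rw [mul_zero, word_zero, word_zero, h.range_mul_range (by lia)], ?_⟩
    have h4 := word_add_two_pow (b := b) (n := n + 1) (k := 0) (s := 0) (by simp)
    rw [pow_zero, word_zero, Nat.cast_zero, sub_zero, h.range_mul_gen le_rfl] at h4
    rw [mul_zero, word_zero, h1, h4]
  · have h1 : 2 * (k + 2 ^ s) = 2 * k + 2 ^ (s + 1) := by ring
    have h2 : 2 * (k + 2 ^ s) + 1 = 2 * k + 1 + 2 ^ (s + 1) := by ring
    have h3 : n + 1 - ((s + 1 : ℕ) : ℤ) = n - s := by push_cast; ring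
    have h4 : 2 * k < 2 ^ (s + 1) := by rw [pow_succ]; lia
    have h5 : 2 * k + 1 < 2 ^ (s + 1) := by rw [pow_succ]; lia
    rw [h2, h1, word_add_two_pow h4, word_add_two_pow h5, word_add_two_pow hk, ih.1, ih.2, h3]
    exact ⟨mul_assoc _ _ _, mul_assoc _ _ _⟩

theorem Rules.star_word_mul_word (h : Rules b) (s k l : ℕ) (hk : k < 2 ^ s) (hl : l < 2 ^ s) :
    star (word b n k) * word b n l =
      star (word b (n + 1) (2 * k)) * word b (n + 1) (2 * l) +
        star (word b (n + 1) (2 * k + 1)) * word b (n + 1) (2 * l + 1) := by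
  -- The first interval is the disjoint union of its two halves; inserting this between the two
  -- words splits the matrix unit.
  have h1 : b n * star (b n) =
      b (n + 1) * star (b (n + 1)) * (b (n + 1) * star (b (n + 1))) +
        star (b (n + 1)) * b (n + 1) := by
    rw [← mul_assoc, h.range_mul_gen le_rfl, h.rule3, add_sub_cancel_right]
    abel
  rw [(h.word_succ s k hk).1, (h.word_succ s k hk).2, (h.word_succ s l hl).1,
    (h.word_succ s l hl).2]
  nth_rw 1 [← h.range_mul_word s l hl]
  rw [h1]
  simp only [star_mul, star_star]
  noncomm_ring

end Word

/-! ### The finite stages are full matrix algebras -/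

section Stage

variable {A : Type*} [CStarAlgebra A] {b : ℤ → A}

theorem word_mem (n : ℕ) {S : NonUnitalStarSubalgebra ℂ A} (hS : ∀ i : ℤ, |i| ≤ n → b i ∈ S)
    (k : ℕ) (hk : k < 2 ^ (2 * n + 1)) : word b n k ∈ S := by
  -- The bound on `s` limits digit positions to at most `2n`, so every letter has index at least
  -- `-n`.
  refine word_induction (P := fun s k => s ≤ 2 * n + 1 → word b n k ∈ S)
    (fun _ => ?_) (fun s k _ ih h => ih (by lia)) (fun s k hk ih h => ?_) _ k hk le_rfl
  · rw [word_zero]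
    have := hS n (by simp)
    exact mul_mem this (star_mem this)
  · rw [word_add_two_pow hk]
    exact mul_mem (ih (by lia)) (hS _ (abs_le.mpr ⟨by lia, by lia⟩))

/-- The matrix units of the algebra generated by the `b i` with `|i| ≤ n`. -/
def Rules.stageHom (h : Rules b) (n : ℕ) :
    Matrix (Fin (2 ^ (2 * n + 1))) (Fin (2 ^ (2 * n + 1))) ℂ →⋆ₙₐ[ℂ] A :=
  matrixHom (fun k => word b n k) (b n * star (b n))
    (fun k l => by rw [h.word_mul_star_word _ k l k.2 l.2]; simp [Fin.ext_iff])
    (fun k => h.range_mul_word _ k k.2)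

theorem Rules.stageHom_apply (h : Rules b) (n : ℕ)
    (X : Matrix (Fin (2 ^ (2 * n + 1))) (Fin (2 ^ (2 * n + 1))) ℂ) :
    h.stageHom n X = ∑ k, ∑ l, X k l • (star (word b n k) * word b n l) := rfl

theorem Rules.range_stageHom (h : Rules b) (n : ℕ) :
    NonUnitalStarAlgHom.range (h.stageHom n) = generated (b '' {i : ℤ | |i| ≤ (n : ℤ)}) := by
  apply le_antisymm
  · rintro _ ⟨X, rfl⟩
    have hS : ∀ i : ℤ, |i| ≤ n → b i ∈ generated (b '' {i : ℤ | |i| ≤ (n : ℤ)}) := fun i hi =>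
      NonUnitalStarSubalgebra.le_topologicalClosure _
        (NonUnitalStarAlgebra.subset_adjoin ℂ _ ⟨i, hi, rfl⟩)
    change h.stageHom n X ∈ _
    rw [h.stageHom_apply]
    exact sum_mem fun k _ => sum_mem fun l _ => SMulMemClass.smul_mem _
      (mul_mem (star_mem (word_mem n hS k k.2)) (word_mem n hS l l.2))
  · refine NonUnitalStarSubalgebra.topologicalClosure_minimal _
      (NonUnitalStarAlgebra.adjoin_le ?_) ?_
    · rintro _ ⟨i, hi, rfl⟩
      obtain ⟨h1, h2⟩ := abs_le.mp (show |i| ≤ (n : ℤ) from hi)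
      obtain ⟨s, hs⟩ := Int.eq_ofNat_of_zero_le (sub_nonneg.mpr h2)
      have h3 := h.gen_eq_sum (n := n) s
      rw [← hs, sub_sub_cancel] at h3
      -- Here `s = n - i ≤ 2n`, so the indices `k + 2 ^ s` occurring in `Rules.gen_eq_sum` stay
      -- within the matrix size.
      have h4 : 2 ^ (s + 1) ≤ 2 ^ (2 * n + 1) := Nat.pow_le_pow_right two_pos (by lia)
      rw [pow_succ] at h4
      rw [h3]
      refine sum_mem fun k hk => ?_
      have hk := Finset.mem_range.mp hk
      refine ⟨Matrix.single ⟨k, by lia⟩ ⟨k + 2 ^ s, by lia⟩ 1, ?_⟩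
      change h.stageHom n _ = _
      rw [h.stageHom_apply, Finset.sum_eq_single ⟨k, by lia⟩,
        Finset.sum_eq_single ⟨k + 2 ^ s, by lia⟩]
      · simp
      · intro l _ hl
        simp [Matrix.single_apply_of_ne _ _ _ _ _ (fun h => hl h.2.symm)]
      · simp
      · intro l _ hl
        refine Finset.sum_eq_zero fun m _ => ?_
        simp [Matrix.single_apply_of_ne _ _ _ _ _ (fun h => hl h.1.symm)]
      · simp
    -- The range is finite-dimensional, hence already closed.
    · exact (LinearMap.range (⟨⟨h.stageHom n, map_add _⟩, map_smul _⟩ :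
        Matrix (Fin (2 ^ (2 * n + 1))) (Fin (2 ^ (2 * n + 1))) ℂ →ₗ[ℂ] A)).closed_of_finiteDimensional

/-- The matrix indices at level `n + 1`, sorted by the blocks of the embedding of level `n`. -/
def sortIndices (n : ℕ) :
    (Σ _ : Unit, Fin 2 × Fin (2 ^ (2 * n + 1))) ⊕ Fin (2 * 2 ^ (2 * n + 1)) ≃
      Fin (2 ^ (2 * (n + 1) + 1)) :=
  (Equiv.sumCongr ((Equiv.uniqueSigma fun _ : Unit => Fin 2 × Fin (2 ^ (2 * n + 1))).trans
    ((Equiv.prodComm _ _).trans finProdFinEquiv)) (Equiv.refl _)).trans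
      (finSumFinEquiv.trans (finCongr (by ring)))

/-- The copy index becomes the lowest binary digit, matching `Rules.word_succ`; the zero block takes
the upper half of the indices. -/
theorem sortIndices_inl (n : ℕ) (e : Fin 2) (k : Fin (2 ^ (2 * n + 1))) :
    (sortIndices n (Sum.inl ⟨(), e, k⟩) : ℕ) = e + 2 * k := rfl

theorem Rules.stageHom_submatrix (h : Rules b) (n : ℕ) {κ : Type*} [Fintype κ]
    (e : κ ≃ Fin (2 ^ (2 * n + 1))) (Y : Matrix κ κ ℂ) :
    h.stageHom n (Y.submatrix e.symm e.symm) =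
      ∑ k, ∑ l, Y k l • (star (word b n (e k : ℕ)) * word b n (e l : ℕ)) := by
  rw [h.stageHom_apply, ← e.sum_comp]
  refine Finset.sum_congr rfl fun k _ => ?_
  rw [← e.sum_comp]
  simp

theorem Rules.stageHom_eq_amplification (h : Rules b) (n : ℕ)
    (X : Matrix (Fin (2 ^ (2 * n + 1))) (Fin (2 ^ (2 * n + 1))) ℂ) :
    h.stageHom n X = h.stageHom (n + 1)
      ((Matrix.fromBlocks
        (Matrix.blockDiagonal' fun _ : Unit => (1 : Matrix (Fin 2) (Fin 2) ℂ) ⊗ₖ X)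
        0 0 0).submatrix (sortIndices n).symm (sortIndices n).symm) := by
  rw [h.stageHom_submatrix, h.stageHom_apply]
  simp only [Fintype.sum_sum_type, Fintype.sum_sigma, Fintype.sum_prod_type, Finset.univ_unique,
    Finset.sum_singleton, Matrix.fromBlocks_apply₁₁, Matrix.fromBlocks_apply₁₂,
    Matrix.fromBlocks_apply₂₁, Matrix.fromBlocks_apply₂₂, Matrix.zero_apply, zero_smul,
    Finset.sum_const_zero, add_zero, PUnit.default_eq_unit, sortIndices_inl,
    Matrix.blockDiagonal'_apply_eq, Matrix.kronecker_apply, Fin.sum_univ_two, Matrix.one_apply_eq]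
  simp only [one_mul, ne_eq, zero_ne_one, one_ne_zero, not_false_eq_true, Matrix.one_apply_ne,
    zero_mul, zero_smul, Finset.sum_const_zero, add_zero, zero_add, ← Finset.sum_add_distrib]
  refine Finset.sum_congr rfl fun k _ => Finset.sum_congr rfl fun l _ => ?_
  rw [h.star_word_mul_word _ k l k.2 l.2, smul_add]
  simp [add_comm]

end Stage

/-- The isomorphism of the `n`-th stage with a full matrix algebra. -/
def blockEquiv (n : ℕ) :
    Matrix (Fin (2 ^ (2 * n + 1))) (Fin (2 ^ (2 * n + 1))) ℂ ≃⋆ₐ[ℂ] block.{u} n :=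
  StarAlgEquiv.ofBijective
    (NonUnitalStarAlgHom.codRestrict (rules_b.{u}.stageHom n) (block.{u} n) fun X => by
      rw [block, ← rules_b.{u}.range_stageHom n]
      exact ⟨X, rfl⟩)
    -- If the range projection of `b n` vanished, so would `b n`.
    ⟨(NonUnitalStarAlgHom.injective_codRestrict _ _ _).mpr <| matrixHom_injective fun h =>
        b_ne_zero.{u} n <| by rw [← rules_b.{u}.range_mul_gen (le_refl (n : ℤ)), h, zero_mul],
      fun x => by
        have hx : x.1 ∈ generated (b.{u} '' {i : ℤ | |i| ≤ (n : ℤ)}) := x.2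
        rw [← rules_b.{u}.range_stageHom n] at hx
        obtain ⟨X, hX⟩ := hx
        exact ⟨X, Subtype.ext hX⟩⟩

theorem coe_blockEquiv (n : ℕ) (X : Matrix (Fin (2 ^ (2 * n + 1))) (Fin (2 ^ (2 * n + 1))) ℂ) :
    (blockEquiv.{u} n X : Univ.{u}) = rules_b.{u}.stageHom n X := rfl

/-! ### The inductive limit and the Bratteli diagram -/

theorem isInductiveLimit_block : IsInductiveLimit J.{u} block.{u} := by
  refine ⟨block_mono, Set.Subset.antisymm ?_ ?_⟩
  · refine closure_minimal (Set.iUnion_subset fun n => ?_)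
      (NonUnitalStarSubalgebra.isClosed_topologicalClosure _)
    exact generated_mono (Set.image_subset_range _ _)
  -- A directed union of `*`-subalgebras is one, so it suffices to locate each generator in some
  -- stage.
  · rw [← NonUnitalStarSubalgebra.coe_iSup_of_directed block_mono.directed_le]
    refine closure_mono (NonUnitalStarAlgebra.adjoin_le ?_)
    rintro _ ⟨i, rfl⟩
    refine (le_iSup block.{u} i.natAbs) ?_
    exact NonUnitalStarSubalgebra.le_topologicalClosure _
      (NonUnitalStarAlgebra.subset_adjoin ℂ _ ⟨i, (Int.natCast_natAbs i).ge, rfl⟩)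

/-- A `*`-algebra as a product with a single factor. -/
def constUnit (R : Type*) [Semiring R] [StarRing R] [Algebra ℂ R] : R ≃⋆ₐ[ℂ] (Unit → R) where
  toFun x _ := x
  invFun x := x ()
  left_inv _ := rfl
  right_inv _ := rfl
  map_mul' _ _ := rfl
  map_add' _ _ := rfl
  map_star' _ := rfl
  map_smul' _ _ := rfl

/-- Turns reindexing into conjugation by a permutation matrix, the unitary that the diagram asks
for. -/
theorem submatrix_one_mul_conjTranspose {κ ι : Type*} [Fintype κ] [Fintype ι] [DecidableEq κ]
    [DecidableEq ι] (e : κ ≃ ι) (M : Matrix κ κ ℂ) :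
    (1 : Matrix ι ι ℂ).submatrix id e * M * ((1 : Matrix ι ι ℂ).submatrix id e)ᴴ =
      M.submatrix e.symm e.symm := by
  rw [Matrix.conjTranspose_submatrix, Matrix.conjTranspose_one, Matrix.one_submatrix_mul,
    Matrix.mul_submatrix_one]
  rfl

theorem conjTranspose_mul_submatrix_one {κ ι : Type*} [Fintype κ] [Fintype ι] [DecidableEq κ]
    [DecidableEq ι] (e : κ ≃ ι) :
    ((1 : Matrix ι ι ℂ).submatrix id e)ᴴ * (1 : Matrix ι ι ℂ).submatrix id e = 1 := by
  rw [Matrix.conjTranspose_submatrix, Matrix.conjTranspose_one,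
    ← Matrix.submatrix_mul _ _ _ _ _ Function.bijective_id, Matrix.one_mul,
    Matrix.submatrix_one_equiv]

theorem blockEquiv_symm_succ (n : ℕ) (x : block.{u} n) (y : block.{u} (n + 1))
    (hxy : (y : Univ.{u}) = x) :
    (blockEquiv (n + 1)).symm y =
      (Matrix.fromBlocks (Matrix.blockDiagonal' fun _ : Unit =>
        (1 : Matrix (Fin 2) (Fin 2) ℂ) ⊗ₖ (blockEquiv n).symm x) 0 0 0).submatrix
          (sortIndices n).symm (sortIndices n).symm := by
  have h1 := coe_blockEquiv n ((blockEquiv n).symm x)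
  rw [StarAlgEquiv.apply_symm_apply, rules_b.{u}.stageHom_eq_amplification n, ← coe_blockEquiv,
    ← hxy] at h1
  rw [Subtype.ext h1, StarAlgEquiv.symm_apply_apply]

theorem coe_inclusion {A : Type*} [CStarAlgebra A] {S T : NonUnitalStarSubalgebra ℂ A}
    (h : S ≤ T) (x : S) : (NonUnitalStarSubalgebra.inclusion h x : A) = x := rfl

theorem isDiagramOf_chain_block : chain.IsDiagramOf block.{u} block_mono.{u} := by
  refine ⟨fun n => (blockEquiv n).symm.trans (constUnit _), fun n w =>
    ⟨2 * 2 ^ (2 * n + 1), (1 : Matrix (Fin (2 ^ (2 * (n + 1) + 1))) _ ℂ).submatrix id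
      (sortIndices n), ?_, conjTranspose_mul_submatrix_one (sortIndices n), fun x => ?_⟩⟩
  · have h1 := submatrix_one_mul_conjTranspose (sortIndices n) 1
    rw [Matrix.mul_one, Matrix.submatrix_one_equiv] at h1
    exact h1
  · exact (blockEquiv_symm_succ n x _ (coe_inclusion _ x)).trans
      (submatrix_one_mul_conjTranspose (sortIndices n) _).symm

end MonotoneAlgebra

end

theorem theorem3p8 :
    MonotoneAlgebra.IsInductiveLimit MonotoneAlgebra.J.{u} MonotoneAlgebra.block.{u} ∧
    (∀ n : ℕ, Nonempty (MonotoneAlgebra.block.{u} n ≃⋆ₐ[ℂ]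
      Matrix (Fin (2 ^ (2 * n + 1))) (Fin (2 ^ (2 * n + 1))) ℂ)) ∧
    MonotoneAlgebra.chain.IsDiagramOf MonotoneAlgebra.block.{u} MonotoneAlgebra.block_mono.{u} ∧
    MonotoneAlgebra.IsAF MonotoneAlgebra.J.{u} :=
  open MonotoneAlgebra in
  ⟨isInductiveLimit_block, fun n => ⟨(blockEquiv n).symm⟩, isDiagramOf_chain_block,
    block, isInductiveLimit_block, fun n =>
      Module.Finite.of_surjective (⟨⟨blockEquiv n, map_add _⟩, map_smul _⟩ :
        Matrix (Fin (2 ^ (2 * n + 1))) (Fin (2 ^ (2 * n + 1))) ℂ →ₗ[ℂ] block.{u} n)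
        (blockEquiv n).surjective⟩
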